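/- Work in ZFC. For an ordinal $\alpha$ consider finite-order logic over structures $(V_\alpha,\in,A)$, $A\subseteq V_\alpha$ a unary predicate, in its full semantics: variables of order $0$ range over $V_\alpha$, and variables of order $i$ over the $i$-th iterated power set of $V_\alpha$. A $\Pi^m_n$ formula consists of $n$ alternating blocks of quantifiers over variables of order $m$, the first block universal, followed by a formula all of whose quantified variables have order less than $m$. A cardinal $\kappa$ is *$\Pi^m_n$ reflecting* if $\kappa$ is (strongly) inaccessible and, for every $A\subseteq V_\kappa$ that is first-order definable over $(V_\kappa,\in)$ with parameters from $V_\kappa$ and every $\Pi^m_n$ sentence $\Phi$ with $(V_\kappa,\in,A)\models\Phi$, there is $\alpha$ with $0<\alpha<\kappa$ and $(V_\alpha,\in,A\cap V_\alpha)\models\Phi$. A cardinal $\kappa$ is *Mahlo* if it is inaccessible and the set of inaccessible cardinals below $\kappa$ is stationary in $\kappa$. **Lemma 3.1 (Mahlo bound).** Let $\kappa$ be a Mahlo cardinal. Then for all $m,n\in\mathbb N$ the set $$\{\alpha<\kappa \mid \alpha \text{ is a } \Pi^m_n \text{ reflecting cardinal}\}$$ is stationary in $\kappa$. Moreover $$(V_\kappa,\in)\models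 \mathrm{ZFC}+\text{``there is a } \Pi^1_1 \text{ reflecting cardinal''},$$ so that the existence of a Mahlo cardinal yields a transitive set model of ZFC with a $\Pi^1_1$ reflecting cardinal: the consistency strength of a $\Pi^1_1$ reflecting cardinal is below that of a Mahlo cardinal. -/

import Mathlib

universe u

namespace Reflection

open Cardinal

/-! ### The language of set theory and first-order definability -/

/-- The only symbol of the first-order language of set theory: a binary relation symbol. -/
inductive MemRel : ℕ → Type
  | mem : MemRel 2

/-- The first-order language `{ε}` of set theory. -/
def Lmem : FirstOrder.Language.{0, 0} := ⟨fun _ => Empty, MemRel⟩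

/-- The structure `(W, ε)` for a set or class `W` of sets: `ε` is true membership. -/
instance memStructure (W : Set ZFSet.{u}) : Lmem.Structure W where
  funMap := fun f => Empty.elim f
  RelMap := fun {_} r => match r with
    | MemRel.mem => fun v => (v 0 : ZFSet.{u}) ∈ (v 1 : ZFSet.{u})

/-- `A` is a subset of `W` that is first-order definable over `(W, ε)` with parameters from `W`. -/
def IsDefinableOver (W A : Set ZFSet.{u}) : Prop :=
  A ⊆ W ∧ (Set.univ : Set W).Definable₁ Lmem {x : W | (x : ZFSet.{u}) ∈ A}

/-! ### Higher-order formulas -/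

/-- Formulas of finite-order logic in the language `{ε, A}`, with `A` a unary predicate symbol.
The variables of order `i` are indexed by natural numbers.  Variables of order `0` range over
individuals, variables of order `i + 1` over sets of objects of order `i`. -/
inductive HOFormula : Type
  /-- `x ε y`, for individual variables `x` and `y` -/
  | mem (x y : ℕ) : HOFormula
  /-- `x ∈ Y`, for `x` of order `i` and `Y` of order `i + 1` -/
  | memSucc (i x y : ℕ) : HOFormula
  /-- `x = y`, for `x` and `y` of order `i` -/
  | eq (i x y : ℕ) : HOFormula
  /-- `A(x)`, for an individual variable `x` -/
  | pred (x : ℕ) : HOFormula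
  | neg (φ : HOFormula) : HOFormula
  | and (φ ψ : HOFormula) : HOFormula
  /-- `∀ x, φ`, for `x` of order `i` -/
  | all (i x : ℕ) (φ : HOFormula) : HOFormula
  /-- `∃ x, φ`, for `x` of order `i` -/
  | ex (i x : ℕ) (φ : HOFormula) : HOFormula

namespace HOFormula

/-- The free variables of a formula, as pairs (order, index). -/
def freeVars : HOFormula → Set (ℕ × ℕ)
  | mem x y => {(0, x), (0, y)}
  | memSucc i x y => {(i, x), (i + 1, y)}
  | eq i x y => {(i, x), (i, y)}
  | pred x => {(0, x)}
  | neg φ => φ.freeVars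
  | and φ ψ => φ.freeVars ∪ ψ.freeVars
  | all i x φ => φ.freeVars \ {(i, x)}
  | ex i x φ => φ.freeVars \ {(i, x)}

/-- A sentence is a formula without free variables. -/
def IsSentence (φ : HOFormula) : Prop := φ.freeVars = ∅

/-- All quantified variables have order less than `m`. -/
def QuantifiersBelow (m : ℕ) : HOFormula → Prop
  | mem _ _ => True
  | memSucc _ _ _ => True
  | eq _ _ _ => True
  | pred _ => True
  | neg φ => φ.QuantifiersBelow m
  | and φ ψ => φ.QuantifiersBelow m ∧ ψ.QuantifiersBelow m
  | all i _ φ => i < m ∧ φ.QuantifiersBelow m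
  | ex i _ φ => i < m ∧ φ.QuantifiersBelow m

mutual

/-- `Π^m_n` formulas: `n` alternating blocks of quantifiers over variables of order `m`, the first
one universal, followed by a formula all of whose quantified variables have order below `m`.
(With individuals of order `0`, the case `m = 1` has quantifiers over subsets of the domain.) -/
def IsPi (m : ℕ) : ℕ → HOFormula → Prop
  | 0, φ => φ.QuantifiersBelow m
  | n + 1, φ => ∃ (xs : List ℕ) (ψ : HOFormula), IsSigma m n ψ ∧ φ = xs.foldr (all m) ψ

/-- `Σ^m_n` formulas: as `Π^m_n` formulas, with the first block existential. -/
def IsSigma (m : ℕ) : ℕ → HOFormula → Prop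
  | 0, φ => φ.QuantifiersBelow m
  | n + 1, φ => ∃ (xs : List ℕ) (ψ : HOFormula), IsPi m n ψ ∧ φ = xs.foldr (ex m) ψ

end

end HOFormula

/-! ### Full higher-order semantics over `V_α`

All notions are relativized to a transitive class `M` of sets; `M = Set.univ` gives the notions
themselves, `M = V_κ` their meaning in the model `(V_κ, ε)`. -/

/-- The objects of order `i` over `V_α`, in the sense of `M`: the individuals are the members of
`V_α`, the objects of order `i + 1` are the sets of objects of order `i`.  For `M = Set.univ` this
is the `i`-th iterated power set of `V_α`. -/
def orderDom (M : Set ZFSet.{u}) (α : Ordinal.{u}) : ℕ → Set ZFSet.{u}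
  | 0 => {x | x ∈ M ∧ x ∈ ZFSet.vonNeumann α}
  | i + 1 => {x | x ∈ M ∧ ∀ y ∈ x, y ∈ orderDom M α i}

/-- Satisfaction of a formula in `(V_α, ε, A)` under the assignment `v`, in the sense of `M`. -/
def HOFormula.Realize (M : Set ZFSet.{u}) (α : Ordinal.{u}) (A : Set ZFSet.{u}) :
    HOFormula → (ℕ × ℕ → ZFSet.{u}) → Prop
  | .mem x y, v => v (0, x) ∈ v (0, y)
  | .memSucc i x y, v => v (i, x) ∈ v (i + 1, y)
  | .eq i x y, v => v (i, x) = v (i, y)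
  | .pred x, v => v (0, x) ∈ A
  | .neg φ, v => ¬ φ.Realize M α A v
  | .and φ ψ, v => φ.Realize M α A v ∧ ψ.Realize M α A v
  | .all i x φ, v => ∀ a ∈ orderDom M α i, φ.Realize M α A (Function.update v (i, x) a)
  | .ex i x φ, v => ∃ a ∈ orderDom M α i, φ.Realize M α A (Function.update v (i, x) a)

/-- `(V_α, ε, A) ⊨ Φ`, for a sentence `Φ`, in the sense of `M`. -/
def Holds (M : Set ZFSet.{u}) (α : Ordinal.{u}) (A : Set ZFSet.{u}) (Φ : HOFormula) : Prop :=
  ∀ v : ℕ × ℕ → ZFSet.{u}, (∀ i k, v (i, k) ∈ orderDom M α i) → Φ.Realize M α A v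

/-- The reflection property, in the sense of `M`: whenever a `Π^m_n` sentence holds in
`(V_κ, ε, A)`, with `A` definable over `V_κ` with parameters, it holds in
`(V_α, ε, A ∩ V_α)` for some `α < κ`.  As structures are non-empty, `α ≠ 0`. -/
def Reflects (M : Set ZFSet.{u}) (m n : ℕ) (κ : Ordinal.{u}) : Prop :=
  ∀ A : Set ZFSet.{u}, IsDefinableOver (orderDom M κ 0) A →
    ∀ Φ : HOFormula, Φ.IsPi m n → Φ.IsSentence → Holds M κ A Φ →
      ∃ α : Ordinal.{u}, 0 < α ∧ α < κ ∧ Holds M α (A ∩ orderDom M α 0) Φ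

/-! ### Reflecting cardinals and Mahlo cardinals -/

/-- `κ` is a `Π^m_n` reflecting cardinal. -/
def IsPiReflecting (m n : ℕ) (κ : Cardinal.{u}) : Prop :=
  κ.IsInaccessible ∧ Reflects Set.univ m n κ.ord

/-- `κ` is a Mahlo cardinal: it is inaccessible and the inaccessible cardinals below `κ` form a
stationary subset of `κ`. -/
def IsMahlo (κ : Cardinal.{u}) : Prop :=
  κ.IsInaccessible ∧
    IsStationary {a : Set.Iio κ.ord | ∃ μ : Cardinal.{u}, μ.IsInaccessible ∧ (a : Ordinal.{u}) = μ.ord}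

/-! ### Models of set theory -/

/-- `(W, ε) ⊨ ZFC`: every axiom, with its quantifiers relativized to `W`. -/
structure ModelsZFC (W : Set ZFSet.{u}) : Prop where
  extensionality : ∀ a b : W, (∀ x : W, x.1 ∈ a.1 ↔ x.1 ∈ b.1) → a = b
  foundation : ∀ a : W, (∃ x : W, x.1 ∈ a.1) → ∃ x : W, x.1 ∈ a.1 ∧ ∀ y : W, y.1 ∈ x.1 → y.1 ∉ a.1
  pairing : ∀ a b : W, ∃ c : W, ∀ x : W, x.1 ∈ c.1 ↔ x = a ∨ x = b
  union : ∀ a : W, ∃ b : W, ∀ x : W, x.1 ∈ b.1 ↔ ∃ y : W, y.1 ∈ a.1 ∧ x.1 ∈ y.1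
  power : ∀ a : W, ∃ b : W, ∀ x : W, x.1 ∈ b.1 ↔ ∀ z : W, z.1 ∈ x.1 → z.1 ∈ a.1
  infinity : ∃ a : W, (∃ e : W, e.1 ∈ a.1 ∧ ∀ x : W, x.1 ∉ e.1) ∧
    ∀ x : W, x.1 ∈ a.1 → ∃ y : W, y.1 ∈ a.1 ∧ ∀ z : W, z.1 ∈ y.1 ↔ z.1 ∈ x.1 ∨ z = x
  separation : ∀ (k : ℕ) (φ : Lmem.Formula (Fin (k + 1))) (p : Fin k → W) (a : W),
    ∃ b : W, ∀ x : W, x.1 ∈ b.1 ↔ x.1 ∈ a.1 ∧ φ.Realize (Fin.cons x p : Fin (k + 1) → W)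
  replacement : ∀ (k : ℕ) (φ : Lmem.Formula (Fin (k + 2))) (p : Fin k → W) (a : W),
    (∀ x : W, x.1 ∈ a.1 →
      ∃! y : W, φ.Realize (Fin.cons x (Fin.cons y p : Fin (k + 1) → W) : Fin (k + 2) → W)) →
    ∃ b : W, ∀ y : W, y.1 ∈ b.1 ↔
      ∃ x : W, x.1 ∈ a.1 ∧
        φ.Realize (Fin.cons x (Fin.cons y p : Fin (k + 1) → W) : Fin (k + 2) → W)
  choice : ∀ a : W, (∀ x : W, x.1 ∈ a.1 → ∃ y : W, y.1 ∈ x.1) →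
    (∀ x y : W, x.1 ∈ a.1 → y.1 ∈ a.1 → x ≠ y → ¬ ∃ z : W, z.1 ∈ x.1 ∧ z.1 ∈ y.1) →
    ∃ c : W, ∀ x : W, x.1 ∈ a.1 → ∃! y : W, y.1 ∈ x.1 ∧ y.1 ∈ c.1

/-- The transitive class `M` satisfies "`α` is an inaccessible cardinal": `α` is uncountable, no
function in `M` from a smaller ordinal to `α` is unbounded, and for every `β < α` the power set of
`β` in `M` is mapped injectively into some `γ < α` by a function in `M`. -/
structure IsInaccessibleIn (M : Set ZFSet.{u}) (α : Ordinal.{u}) : Prop where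
  mem : α.toZFSet ∈ M
  omega_lt : Ordinal.omega0 < α
  regular : ∀ β < α, ∀ f ∈ M, ZFSet.IsFunc β.toZFSet α.toZFSet f →
    ∃ γ < α, ∀ ξ δ : Ordinal.{u}, ZFSet.pair ξ.toZFSet δ.toZFSet ∈ f → δ < γ
  strongLimit : ∀ β < α, ∃ p ∈ M, (∀ x, x ∈ p ↔ x ∈ M ∧ x ⊆ β.toZFSet) ∧
    ∃ γ < α, ∃ f ∈ M, ZFSet.IsFunc p γ.toZFSet f ∧
      ∀ x y z, ZFSet.pair x z ∈ f → ZFSet.pair y z ∈ f → x = y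

/-- The transitive class `M` satisfies "`α` is a `Π^m_n` reflecting cardinal". -/
def IsPiReflectingIn (M : Set ZFSet.{u}) (m n : ℕ) (α : Ordinal.{u}) : Prop :=
  IsInaccessibleIn M α ∧ Reflects M m n α

end Reflection

namespace Reflection

open Cardinal

-- Code a set `D` definable over `V_κ` by a formula and a finite list of parameters. Fewer than `κ`
-- codes have their parameters in a given `V_b`, `b < κ`, so a closing-off argument
-- (`isClub_setOf_closed`) yields a club of `a < κ` such that `V_a` is elementary in `V_κ` and,
-- whenever the parameters of `D` lie in `V_a`, a sentence true in `(V_β, ∈, D ∩ V_β)` for some `0 <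
-- β < κ` is true for some such `β < a`.
--
-- As `κ` is Mahlo, this club meets every given club in an inaccessible `a`. By elementarity a
-- definable `A ⊆ V_a` has the form `D ∩ V_a` (`IsDefinableOver.exists_eq_definedSet_inter`). If `Φ`
-- holds in `(V_a, ∈, A)`, then `β = a` is a witness below `κ`, hence there is one below `a`
-- (`reflects_of_closed`). One club thus serves all `m` and `n`.
--
-- For the second claim, `V_κ` is a model of ZFC that contains every object of finite order over
-- `V_a`, `a < κ`, so a reflecting cardinal below `κ` remains one in the sense of `V_κ`.

-- Closing off below an inaccessible cardinal

theorem exists_forall_lt_of_isRegular {κ : Cardinal.{u}} (hκ : κ.IsRegular) {ι : Type*}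
    (hι : Cardinal.lift.{u} #ι < Cardinal.lift κ) (f : ι → Ordinal.{u})
    (hf : ∀ i, f i < κ.ord) : ∃ b < κ.ord, ∀ i, f i < b := by
  refine ⟨⨆ i, f i + 1, Ordinal.lift_iSup_add_one_lt_of_lt_cof ?_ hf, fun i => ?_⟩
  · rwa [← Ordinal.lift_cof, hκ.cof_ord]
  · refine (lt_add_one (f i)).trans_le (le_ciSup (f := fun i => f i + 1) ⟨κ.ord, ?_⟩ i)
    rintro _ ⟨j, rfl⟩
    exact Order.add_one_le_of_lt (hf j)

theorem card_lt_of_mem_vonNeumann {κ : Cardinal.{u}} (hκ : κ.IsInaccessible) {x : ZFSet.{u}}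
    (hx : x ∈ ZFSet.vonNeumann κ.ord) : x.card < κ := by
  refine (ZFSet.card_mono (ZFSet.subset_vonNeumann_self x)).trans_lt ?_
  rw [ZFSet.card_vonNeumann]
  conv_rhs => rw [← hκ.preBeth_ord]
  exact preBeth_strictMono (ZFSet.mem_vonNeumann.1 hx)

/-- If all members of a set that has fewer than `κ` elements are in `V_κ`, so is the set. -/
theorem mem_vonNeumann_of_card_lt {κ : Cardinal.{u}} (hκ : κ.IsInaccessible) {x : ZFSet.{u}}
    (hc : x.card < κ) (hx : ∀ y ∈ x, y ∈ ZFSet.vonNeumann κ.ord) :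
    x ∈ ZFSet.vonNeumann κ.ord := by
  obtain ⟨b, hb, h⟩ := exists_forall_lt_of_isRegular hκ.isRegular (ι := x)
    (by rw [ZFSet.cardinalMk_coe_sort, Cardinal.lift_lift, Cardinal.lift_lt]; exact hc)
    (fun y => y.1.rank) (fun y => ZFSet.mem_vonNeumann.1 (hx y.1 y.2))
  exact ZFSet.mem_vonNeumann.2 ((ZFSet.rank_le_iff.2 fun y hy => h ⟨y, hy⟩).trans_lt hb)

/-- One closing-off step: choose a witness for each pair of an index and a list over `V_b`. There
are fewer than `κ` pairs, so regularity bounds the witnesses. -/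
theorem exists_forall_list_lt {κ : Cardinal.{u}} (hκ : κ.IsInaccessible) {C : Type} [Countable C]
    (Q : C → List ZFSet.{u} → Ordinal.{u} → Prop) {b : Ordinal.{u}} (hb : b < κ.ord) :
    ∃ b' < κ.ord, b < b' ∧ ∀ c l, (∀ x ∈ l, x ∈ ZFSet.vonNeumann b) →
      (∃ β < κ.ord, Q c l β) → ∃ β < b', Q c l β := by
  classical
  let f : C × List (ZFSet.vonNeumann b) → Ordinal.{u} := fun p =>
    if h : ∃ β < κ.ord, Q p.1 (p.2.map Subtype.val) β then h.choose else 0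
  have h0 : 0 < κ.ord := bot_le.trans_lt hb
  have hf : ∀ p, f p < κ.ord := fun p => by
    by_cases h : ∃ β < κ.ord, Q p.1 (p.2.map Subtype.val) β
    · simpa only [f, dif_pos h] using h.choose_spec.1
    · simpa only [f, dif_neg h] using h0
  have hl : #(List (ZFSet.vonNeumann b)) < Cardinal.lift.{u + 1} κ := by
    refine (mk_list_le_max _).trans_lt (max_lt ?_ ?_)
    · simpa using hκ.aleph0_lt
    · rw [ZFSet.cardinalMk_coe_sort, Cardinal.lift_lt]
      exact card_lt_of_mem_vonNeumann hκ (ZFSet.vonNeumann_mem_of_lt hb)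
  have hc : Cardinal.lift.{u} #(C × List (ZFSet.vonNeumann b)) < Cardinal.lift.{u + 1} κ := by
    rw [Cardinal.lift_id'.{u, u + 1}, mk_prod]
    refine mul_lt_of_lt (by simpa using hκ.aleph0_lt.le) ?_ (by simpa using hl)
    refine lt_of_le_of_lt (Cardinal.lift_le.2 (mk_le_aleph0 (α := C))) ?_
    simpa using hκ.aleph0_lt
  obtain ⟨b₁, hb₁, h₁⟩ := exists_forall_lt_of_isRegular hκ.isRegular hc f hf
  refine ⟨max b₁ (b + 1), max_lt hb₁ ?_, lt_max_of_lt_right (lt_add_one b), fun c l hl h => ?_⟩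
  · exact (isSuccLimit_ord hκ.aleph0_lt.le).add_one_lt hb
  · lift l to List (ZFSet.vonNeumann b) using hl
    refine ⟨f (c, l), lt_max_of_lt_left (h₁ _), ?_⟩
    simp only [f, dif_pos h]
    exact h.choose_spec.2

/-- A finite list has only finitely many ranks, so one stage of an increasing union captures it. -/
theorem exists_forall_list_mem_vonNeumann {S : Set Ordinal.{u}} (hS : S.Nonempty)
    {a : Ordinal.{u}} (ha : ∀ b < a, ∃ s ∈ S, b < s) (l : List ZFSet.{u})
    (hl : ∀ x ∈ l, x ∈ ZFSet.vonNeumann a) :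
    ∃ s ∈ S, ∀ x ∈ l, x ∈ ZFSet.vonNeumann s := by
  induction l with
  | nil => exact hS.imp fun s hs => ⟨hs, by simp⟩
  | cons x l ih =>
    obtain ⟨s, hs, h⟩ := ih fun y hy => hl y (List.mem_cons_of_mem _ hy)
    obtain ⟨t, ht, hx⟩ := ha _ (ZFSet.mem_vonNeumann.1 (hl x List.mem_cons_self))
    refine ⟨max s t, by rcases max_choice s t with e | e <;> rwa [e], fun y hy => ?_⟩
    rcases List.mem_cons.1 hy with rfl | hy
    · exact ZFSet.mem_vonNeumann.2 (lt_max_of_lt_right hx)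
    · exact ZFSet.vonNeumann_subset_of_le (le_max_left s t) (h y hy)

/-- Countably many existential properties of finite sequences from `V_κ` are reflected by all `a`
in a club of `κ`. -/
theorem isClub_setOf_closed {κ : Cardinal.{u}} (hκ : κ.IsInaccessible) {C : Type} [Countable C]
    (Q : C → List ZFSet.{u} → Ordinal.{u} → Prop) :
    IsClub {a : Set.Iio κ.ord | ∀ c l, (∀ x ∈ l, x ∈ ZFSet.vonNeumann (a : Ordinal.{u})) →
      (∃ β < κ.ord, Q c l β) → ∃ β < (a : Ordinal.{u}), Q c l β} where
  dirSupClosed := by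
    intro d hd hne _ a ha c l hl h
    obtain ⟨_, ⟨s, hs, rfl⟩, hsl⟩ := exists_forall_list_mem_vonNeumann
      (S := Subtype.val '' d) (hne.image _) (a := a) (fun b hb => by
        obtain ⟨s, hs, h⟩ := (lt_isLUB_iff ha (b := ⟨b, hb.trans a.2⟩)).1 hb
        exact ⟨s, ⟨s, hs, rfl⟩, h⟩) l hl
    obtain ⟨β, hβ, hQ⟩ := hd hs c l hsl h
    exact ⟨β, hβ.trans_le (ha.1 hs), hQ⟩
  isCofinal := by
    intro a₀
    choose s hs using fun b : Set.Iio κ.ord => exists_forall_list_lt hκ Q b.2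
    -- Iterate the closing-off step `ω` times; the supremum stays below `κ` because `κ` has
    -- uncountable cofinality. A list over the supremum appears at some stage `n`, and its witness
    -- before stage `n + 1`.
    let g : ℕ → Set.Iio κ.ord := fun n => Nat.rec a₀ (fun _ b => ⟨s b, (hs b).1⟩) n
    let o : ℕ → Ordinal.{u} := fun n => (g n).1
    have ho : ∀ n, o (n + 1) = s (g n) := fun n => rfl
    have hbdd : BddAbove (Set.range o) :=
      ⟨κ.ord, by rintro _ ⟨n, rfl⟩; exact (g n).2.le⟩
    have hlt : (⨆ n, o n) < κ.ord := by
      refine Ordinal.lift_iSup_lt_of_lt_cof (f := o) ?_ fun n => (g n).2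
      rw [← Ordinal.lift_cof, hκ.isRegular.cof_ord]
      simpa using hκ.aleph0_lt
    refine ⟨⟨_, hlt⟩, fun c l hl h => ?_, le_ciSup hbdd 0⟩
    obtain ⟨_, ⟨n, rfl⟩, hn⟩ := exists_forall_list_mem_vonNeumann
      (S := Set.range o) (Set.range_nonempty _)
      (a := ⨆ n, o n) (fun b hb => by
        obtain ⟨n, hn⟩ := exists_lt_of_lt_ciSup hb
        exact ⟨_, ⟨n, rfl⟩, hn⟩) l hl
    obtain ⟨β, hβ, hQ⟩ := (hs (g n)).2.2 c l hn h
    exact ⟨β, hβ.trans_le ((ho n).ge.trans (le_ciSup hbdd (n + 1))), hQ⟩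

-- Countability of the sets of formulas

namespace HOFormula

/-- A Gödel numbering of higher-order formulas. -/
def code : HOFormula → ℕ
  | mem x y => Nat.pair 0 (Nat.pair x y)
  | memSucc i x y => Nat.pair 1 (Nat.pair i (Nat.pair x y))
  | eq i x y => Nat.pair 2 (Nat.pair i (Nat.pair x y))
  | pred x => Nat.pair 3 x
  | neg φ => Nat.pair 4 φ.code
  | and φ ψ => Nat.pair 5 (Nat.pair φ.code ψ.code)
  | all i x φ => Nat.pair 6 (Nat.pair i (Nat.pair x φ.code))
  | ex i x φ => Nat.pair 7 (Nat.pair i (Nat.pair x φ.code))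

theorem code_injective : Function.Injective code := by
  intro φ
  induction φ with
  | neg φ ih =>
    intro ψ h
    cases ψ <;> simp [code, Nat.pair_eq_pair] at h
    rw [ih h]
  | and φ φ' ih ih' =>
    intro ψ h
    cases ψ <;> simp [code, Nat.pair_eq_pair] at h
    rw [ih h.1, ih' h.2]
  | all i x φ ih =>
    intro ψ h
    cases ψ <;> simp [code, Nat.pair_eq_pair] at h
    rw [h.1, h.2.1, ih h.2.2]
  | ex i x φ ih =>
    intro ψ h
    cases ψ <;> simp [code, Nat.pair_eq_pair] at h
    rw [h.1, h.2.1, ih h.2.2]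
  | _ => intro ψ h; cases ψ <;> simp_all [code, Nat.pair_eq_pair]

instance : Countable HOFormula := code_injective.countable

end HOFormula

instance : Countable (Σ n, MemRel n) :=
  Function.Injective.countable (f := fun _ => (0 : ℕ)) (by rintro ⟨_, ⟨⟩⟩ ⟨_, ⟨⟩⟩ _; rfl)

instance : Countable (Σ n, Lmem.Functions n) :=
  Function.Injective.countable (f := fun _ => (0 : ℕ)) fun x => Empty.elim x.2

instance : Countable Lmem.Symbols :=
  inferInstanceAs (Countable ((Σ n, Lmem.Functions n) ⊕ (Σ n, MemRel n)))

instance (n : ℕ) : Countable (Lmem.BoundedFormula Empty n) :=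
  (sigma_mk_injective (i := n)).countable

-- Elementarity of `V_a` in `V_κ`

/-- The inclusion of `V_a` in `V_b`, for `a ≤ b`. -/
def orderDomInclusion {a b : Ordinal.{u}} (h : a ≤ b) :
    FirstOrder.Language.Embedding Lmem (orderDom Set.univ a 0) (orderDom Set.univ b 0) where
  toFun x := ⟨x.1, trivial, ZFSet.vonNeumann_subset_of_le h x.2.2⟩
  inj' x y h := Subtype.ext (congrArg (fun z => z.1) h)
  map_fun' f := Empty.elim f
  map_rel' r _ := by cases r; rfl

/-- The ordinal `a` is the rank of a witness that the Tarski-Vaught test for substructures of `V_κ`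
asks for. -/
def IsWitnessRank (κ : Ordinal.{u}) (c : Σ n, Lmem.BoundedFormula Empty (n + 1))
    (l : List ZFSet.{u}) (a : Ordinal.{u}) : Prop :=
  ∃ (x : Fin c.1 → orderDom Set.univ κ 0) (y : orderDom Set.univ κ 0),
    l = List.ofFn (fun i => (x i : ZFSet.{u})) ∧ (y : ZFSet.{u}).rank = a ∧
      c.2.Realize default (Fin.snoc x y : Fin (c.1 + 1) → orderDom Set.univ κ 0)

/-- The Tarski-Vaught test: closure supplies a witness of rank below `a`, that is, one in `V_a`. -/
theorem realize_orderDomInclusion {a κ : Ordinal.{u}} (h : a ≤ κ)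
    (hc : ∀ c l, (∀ x ∈ l, x ∈ ZFSet.vonNeumann a) →
      (∃ β < κ, IsWitnessRank κ c l β) → ∃ β < a, IsWitnessRank κ c l β) {n : ℕ}
    (φ : Lmem.Formula (Fin n)) (x : Fin n → orderDom Set.univ a 0) :
    φ.Realize (orderDomInclusion h ∘ x) ↔ φ.Realize x := by
  refine (orderDomInclusion h).isElementary_of_exists (fun n φ x y hy => ?_) φ x
  obtain ⟨β, hβ, x', y', hl, hr, hφ⟩ := hc ⟨n, φ⟩ (List.ofFn fun i => (x i : ZFSet.{u}))
    (by simpa [List.mem_ofFn] using fun i => (x i).2.2)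
    ⟨_, ZFSet.mem_vonNeumann.1 y.2.2, orderDomInclusion h ∘ x, y, rfl, rfl, hy⟩
  obtain rfl : orderDomInclusion h ∘ x = x' :=
    funext fun i => Subtype.ext (congrFun (List.ofFn_injective hl) i)
  exact ⟨⟨y', trivial, ZFSet.mem_vonNeumann.2 (hr.trans_lt hβ)⟩, hφ⟩

/-! ### `V_κ` is a model of ZFC -/

section ZFC

variable {κ : Cardinal.{u}}

theorem omega0_lt_ord (hκ : κ.IsInaccessible) : Ordinal.omega0.{u} < κ.ord := by
  rw [Cardinal.lt_ord, Ordinal.card_omega0]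
  exact hκ.aleph0_lt

theorem exists_mem_iff_and (κ : Cardinal.{u}) (P : ZFSet.{u} → Prop)
    {a : ZFSet.{u}} (ha : a ∈ ZFSet.vonNeumann κ.ord) :
    ∃ b : {x : ZFSet.{u} | x ∈ ZFSet.vonNeumann κ.ord},
      ∀ x : {x : ZFSet.{u} | x ∈ ZFSet.vonNeumann κ.ord}, x.1 ∈ b.1 ↔ x.1 ∈ a ∧ P x.1 :=
  ⟨⟨ZFSet.sep P a, ZFSet.mem_vonNeumann_of_subset ZFSet.sep_subset ha⟩, fun _ => ZFSet.mem_sep⟩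

theorem pair_mem_vonNeumann (hκ : κ.IsInaccessible) {a b : ZFSet.{u}}
    (ha : a ∈ ZFSet.vonNeumann κ.ord) (hb : b ∈ ZFSet.vonNeumann κ.ord) :
    ({a, b} : ZFSet.{u}) ∈ ZFSet.vonNeumann κ.ord := by
  rw [ZFSet.mem_vonNeumann] at *
  rw [ZFSet.rank_pair]
  exact max_lt ((isSuccLimit_ord hκ.aleph0_lt.le).succ_lt ha)
    ((isSuccLimit_ord hκ.aleph0_lt.le).succ_lt hb)

theorem sUnion_mem_vonNeumann {o : Ordinal.{u}} {a : ZFSet.{u}} (ha : a ∈ ZFSet.vonNeumann o) :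
    (ZFSet.sUnion a) ∈ ZFSet.vonNeumann o := by
  rw [ZFSet.mem_vonNeumann] at *
  exact (ZFSet.rank_sUnion_le a).trans_lt ha

theorem powerset_mem_vonNeumann (hκ : κ.IsInaccessible) {a : ZFSet.{u}}
    (ha : a ∈ ZFSet.vonNeumann κ.ord) : a.powerset ∈ ZFSet.vonNeumann κ.ord := by
  rw [ZFSet.mem_vonNeumann] at *
  rw [ZFSet.rank_powerset]
  exact (isSuccLimit_ord hκ.aleph0_lt.le).succ_lt ha

theorem prod_mem_vonNeumann (hκ : κ.IsInaccessible) {a b : ZFSet.{u}}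
    (ha : a ∈ ZFSet.vonNeumann κ.ord) (hb : b ∈ ZFSet.vonNeumann κ.ord) :
    a.prod b ∈ ZFSet.vonNeumann κ.ord := by
  refine ZFSet.mem_vonNeumann_of_subset ?_ (powerset_mem_vonNeumann hκ
    (powerset_mem_vonNeumann hκ (sUnion_mem_vonNeumann (pair_mem_vonNeumann hκ ha hb))))
  rw [ZFSet.sUnion_pair]
  unfold ZFSet.prod ZFSet.pairSep
  exact ZFSet.sep_subset

theorem range_mem_vonNeumann (hκ : κ.IsInaccessible) {a : ZFSet.{u}}
    (ha : a ∈ ZFSet.vonNeumann κ.ord) (f : a → ZFSet.{u})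
    (hf : ∀ x, f x ∈ ZFSet.vonNeumann κ.ord) : ZFSet.range f ∈ ZFSet.vonNeumann κ.ord := by
  refine mem_vonNeumann_of_card_lt hκ (lt_of_le_of_lt ?_ (card_lt_of_mem_vonNeumann hκ ha)) ?_
  · have h := ZFSet.lift_card_range_le (f := f)
    rw [ZFSet.cardinalMk_coe_sort, Cardinal.lift_id'.{u, u + 1}, Cardinal.lift_le] at h
    exact h
  · intro y hy
    obtain ⟨x, rfl⟩ := ZFSet.mem_range.1 hy
    exact hf x

theorem modelsZFC_vonNeumann (hκ : κ.IsInaccessible) :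
    ModelsZFC {x : ZFSet.{u} | x ∈ ZFSet.vonNeumann κ.ord} := by
  have tr : ∀ {x y : ZFSet.{u}}, y ∈ ZFSet.vonNeumann κ.ord → x ∈ y →
      x ∈ ZFSet.vonNeumann κ.ord := fun hy hx =>
    (ZFSet.isTransitive_vonNeumann _).mem_trans hx hy
  constructor
  case extensionality =>
    rintro ⟨a, ha⟩ ⟨b, hb⟩ h
    exact Subtype.ext (ZFSet.ext fun x =>
      ⟨fun hx => (h ⟨x, tr ha hx⟩).1 hx, fun hx => (h ⟨x, tr hb hx⟩).2 hx⟩)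
  case foundation =>
    rintro ⟨a, ha⟩ ⟨x, hx⟩
    obtain ⟨y, hy, h⟩ := ZFSet.regularity a (fun h => ZFSet.notMem_empty x.1 (h ▸ hx))
    refine ⟨⟨y, tr ha hy⟩, hy, fun z hz hza => ?_⟩
    exact ZFSet.notMem_empty z.1 (h ▸ ZFSet.mem_inter.2 ⟨hza, hz⟩)
  case pairing =>
    rintro ⟨a, ha⟩ ⟨b, hb⟩
    exact ⟨⟨{a, b}, pair_mem_vonNeumann hκ ha hb⟩, fun x => by simp [Subtype.ext_iff]⟩
  case union =>
    rintro ⟨a, ha⟩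
    refine ⟨⟨_, sUnion_mem_vonNeumann ha⟩, fun x => ZFSet.mem_sUnion.trans ?_⟩
    exact ⟨fun ⟨y, hy, hx⟩ => ⟨⟨y, tr ha hy⟩, hy, hx⟩, fun ⟨y, hy, hx⟩ => ⟨y, hy, hx⟩⟩
  case power =>
    rintro ⟨a, ha⟩
    refine ⟨⟨_, powerset_mem_vonNeumann hκ ha⟩, fun x => ZFSet.mem_powerset.trans ?_⟩
    exact ⟨fun h z hz => h hz, fun h z hz => h ⟨z, tr x.2 hz⟩ hz⟩
  case infinity =>
    have hω : ∀ {x : ZFSet.{u}}, x ∈ ZFSet.vonNeumann Ordinal.omega0 →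
        x ∈ ZFSet.vonNeumann κ.ord :=
      fun h => ZFSet.vonNeumann_subset_of_le (omega0_lt_ord hκ).le h
    refine ⟨⟨ZFSet.vonNeumann Ordinal.omega0, ZFSet.vonNeumann_mem_of_lt (omega0_lt_ord hκ)⟩,
      ?_, fun x hx => ?_⟩
    · have h : (∅ : ZFSet.{u}) ∈ ZFSet.vonNeumann Ordinal.omega0 := by
        rw [ZFSet.mem_vonNeumann, ZFSet.rank_empty]
        exact Ordinal.omega0_pos
      exact ⟨⟨∅, hω h⟩, h, fun x => ZFSet.notMem_empty _⟩
    · have h : insert x.1 x.1 ∈ ZFSet.vonNeumann Ordinal.omega0 := by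
        have hx' := ZFSet.mem_vonNeumann.1 hx
        rw [ZFSet.mem_vonNeumann, ZFSet.rank_insert]
        exact max_lt (Ordinal.isSuccLimit_omega0.succ_lt hx') hx'
      refine ⟨⟨_, hω h⟩, h, fun z => ?_⟩
      rw [ZFSet.mem_insert_iff, or_comm, Subtype.ext_iff]
  case separation =>
    intro k φ p a
    -- The existential over membership proofs turns a property of elements of `V_κ` into one of
    -- arbitrary sets.
    obtain ⟨b, hb⟩ := exists_mem_iff_and κ (fun x => ∃ h : x ∈ ZFSet.vonNeumann κ.ord,
      φ.Realize (Fin.cons (⟨x, h⟩ : {x : ZFSet.{u} | x ∈ ZFSet.vonNeumann κ.ord}) p :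
        Fin (k + 1) → {x : ZFSet.{u} | x ∈ ZFSet.vonNeumann κ.ord})) a.2
    exact ⟨b, fun x => (hb x).trans (and_congr_right fun _ => ⟨fun h => h.2, fun h => ⟨x.2, h⟩⟩)⟩
  case replacement =>
    rintro k φ p ⟨a, ha⟩ h
    choose f hf hu using fun x : a => h ⟨x.1, tr ha x.2⟩ x.2
    refine ⟨⟨ZFSet.range fun x => (f x).1, range_mem_vonNeumann hκ ha _ fun x => (f x).2⟩,
      fun y => ZFSet.mem_range.trans ⟨?_, ?_⟩⟩
    · rintro ⟨x, hx⟩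
      obtain rfl : f x = y := Subtype.ext hx
      exact ⟨_, x.2, hf x⟩
    · rintro ⟨x, hx, hy⟩
      exact ⟨⟨x.1, hx⟩, congrArg _ (hu ⟨x.1, hx⟩ y hy).symm⟩
  case choice =>
    rintro ⟨a, ha⟩ hne hd
    choose f hf using fun x : a => hne ⟨x.1, tr ha x.2⟩ x.2
    refine ⟨⟨ZFSet.range fun x => (f x).1, range_mem_vonNeumann hκ ha _ fun x => (f x).2⟩,
      fun x hx => ⟨f ⟨x.1, hx⟩, ⟨hf ⟨x.1, hx⟩, ZFSet.mem_range_self _⟩, ?_⟩⟩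
    rintro y ⟨hyx, hy⟩
    obtain ⟨z, hz⟩ := ZFSet.mem_range.1 hy
    -- The chosen element of `z` lies in `x` too, so disjointness forces `z = x`.
    have hzx : (⟨z.1, tr ha z.2⟩ : {x : ZFSet.{u} | x ∈ ZFSet.vonNeumann κ.ord}) = x := by
      by_contra hne'
      exact hd _ _ z.2 hx hne' ⟨f z, hf z, hz.symm ▸ hyx⟩
    subst hzx
    exact Subtype.ext hz.symm

end ZFC

/-! ### Absoluteness between `V_κ` and the universe -/

/-- Objects of order `i` over `V_a` have rank at most `a + i`, which is below the limit ordinal `κ`.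
-/
theorem orderDom_eq_univ {κ : Cardinal.{u}} (hκ : κ.IsInaccessible) {a : Ordinal.{u}}
    (ha : a < κ.ord) (i : ℕ) :
    orderDom {x : ZFSet.{u} | x ∈ ZFSet.vonNeumann κ.ord} a i = orderDom Set.univ a i := by
  have hlim := isSuccLimit_ord hκ.aleph0_lt.le
  have key : ∀ i : ℕ, a + i < κ.ord ∧
      ∀ x ∈ orderDom (Set.univ : Set ZFSet.{u}) a i, x.rank ≤ a + i := by
    intro i
    induction i with
    | zero => simpa [orderDom] using ⟨ha, fun x hx => (ZFSet.mem_vonNeumann.1 hx).le⟩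
    | succ i ih =>
      rw [Nat.cast_succ, ← add_assoc]
      refine ⟨hlim.add_one_lt ih.1, fun x hx => ZFSet.rank_le_iff.2 fun y hy => ?_⟩
      exact Order.lt_add_one_iff.2 (ih.2 y (hx.2 y hy))
  induction i with
  | zero =>
    exact Set.ext fun x => ⟨fun h => ⟨trivial, h.2⟩,
      fun h => ⟨ZFSet.vonNeumann_subset_of_le ha.le h.2, h.2⟩⟩
  | succ i ih =>
    ext x
    refine ⟨fun h => ⟨trivial, ih ▸ h.2⟩, fun h => ⟨?_, ih.symm ▸ h.2⟩⟩
    exact ZFSet.mem_vonNeumann.2 (((key _).2 x h).trans_lt (key _).1)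

theorem holds_iff_of_orderDom_eq {M N : Set ZFSet.{u}} {a : Ordinal.{u}}
    (h : ∀ i, orderDom M a i = orderDom N a i) (A : Set ZFSet.{u}) (Φ : HOFormula) :
    Holds M a A Φ ↔ Holds N a A Φ := by
  have hr : ∀ v, Φ.Realize M a A v ↔ Φ.Realize N a A v := by
    induction Φ with
    | neg φ ih => exact fun v => not_congr (ih v)
    | and φ ψ ih ih' => exact fun v => and_congr (ih v) (ih' v)
    | all i x φ ih => simp [HOFormula.Realize, h, ih]
    | ex i x φ ih => simp [HOFormula.Realize, h, ih]
    | _ => exact fun v => Iff.rfl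
  simp only [Holds, h, hr]

theorem Reflects.vonNeumann {κ : Cardinal.{u}} (hκ : κ.IsInaccessible) {a : Ordinal.{u}}
    (ha : a < κ.ord) {m n : ℕ} (h : Reflects Set.univ m n a) :
    Reflects {x : ZFSet.{u} | x ∈ ZFSet.vonNeumann κ.ord} m n a := by
  intro A hA Φ hΦ hs hH
  rw [orderDom_eq_univ hκ ha] at hA
  rw [holds_iff_of_orderDom_eq (orderDom_eq_univ hκ ha)] at hH
  obtain ⟨b, hb0, hb, hbH⟩ := h A hA Φ hΦ hs hH
  refine ⟨b, hb0, hb, ?_⟩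
  rwa [holds_iff_of_orderDom_eq (orderDom_eq_univ hκ (hb.trans ha)),
    orderDom_eq_univ hκ (hb.trans ha)]

theorem toZFSet_mem_vonNeumann {a b : Ordinal.{u}} (h : a < b) :
    a.toZFSet ∈ ZFSet.vonNeumann b :=
  ZFSet.mem_vonNeumann.2 (by rwa [Ordinal.rank_toZFSet])

/-- A bijection with the initial ordinal, coded as a set of pairs; it witnesses the strong limit
clause inside `V_κ`. -/
theorem exists_injective_isFunc (p : ZFSet.{u}) :
    ∃ f, ZFSet.IsFunc p p.card.ord.toZFSet f ∧
      ∀ x y z, ZFSet.pair x z ∈ f → ZFSet.pair y z ∈ f → x = y := by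
  have hc : #p = #(Set.Iio p.card.ord) := by
    rw [ZFSet.cardinalMk_coe_sort, mk_Iio_ordinal, card_ord]
  obtain ⟨e⟩ := Cardinal.eq.1 hc
  have hm : ∀ {x z}, ZFSet.pair x z ∈ ZFSet.sep (fun w => ∃ x : p,
      w = ZFSet.pair x.1 (e x).1.toZFSet) (p.prod p.card.ord.toZFSet) ↔
        ∃ h : x ∈ p, z = (e ⟨x, h⟩).1.toZFSet := by
    intro x z
    rw [ZFSet.mem_sep, ZFSet.pair_mem_prod]
    constructor
    · rintro ⟨-, y, h⟩
      obtain ⟨rfl, rfl⟩ := ZFSet.pair_inj.1 h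
      exact ⟨y.2, rfl⟩
    · rintro ⟨h, rfl⟩
      exact ⟨⟨h, Ordinal.toZFSet_mem_toZFSet_iff.2 (e ⟨x, h⟩).2⟩, ⟨x, h⟩, rfl⟩
  refine ⟨_, ⟨ZFSet.sep_subset, fun x hx => ⟨_, hm.2 ⟨hx, rfl⟩, fun z hz => (hm.1 hz).2⟩⟩,
    fun x y z hx hy => ?_⟩
  obtain ⟨hx, rfl⟩ := hm.1 hx
  obtain ⟨hy, h⟩ := hm.1 hy
  exact congrArg Subtype.val (e.injective (Subtype.ext (Ordinal.toZFSet_injective h)))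

theorem isInaccessibleIn_vonNeumann {κ μ : Cardinal.{u}} (hκ : κ.IsInaccessible)
    (hμ : μ.IsInaccessible) (h : μ.ord < κ.ord) :
    IsInaccessibleIn {x : ZFSet.{u} | x ∈ ZFSet.vonNeumann κ.ord} μ.ord where
  mem := toZFSet_mem_vonNeumann h
  omega_lt := omega0_lt_ord hμ
  regular β hβ f _ hf := by
    have H : ∀ ξ : Set.Iio β, ∃ δ < μ.ord, ∀ δ' : Ordinal.{u},
        ZFSet.pair ξ.1.toZFSet δ'.toZFSet ∈ f → δ' = δ := fun ξ => by
      obtain ⟨w, hw, hu⟩ := hf.2 ξ.1.toZFSet (Ordinal.toZFSet_mem_toZFSet_iff.2 ξ.2)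
      obtain ⟨δ, hδ, rfl⟩ := Ordinal.mem_toZFSet_iff.1 (ZFSet.pair_mem_prod.1 (hf.1 hw)).2
      exact ⟨δ, hδ, fun δ' h' => Ordinal.toZFSet_injective (hu _ h')⟩
    choose g hg hgu using H
    obtain ⟨γ, hγ, hlt⟩ := exists_forall_lt_of_isRegular hμ.isRegular (ι := Set.Iio β)
      (by rw [mk_Iio_ordinal, Cardinal.lift_lift, Cardinal.lift_lt]; exact Cardinal.lt_ord.1 hβ)
      g hg
    refine ⟨γ, hγ, fun ξ δ hξ => ?_⟩
    have hξβ := Ordinal.toZFSet_mem_toZFSet_iff.1 (ZFSet.pair_mem_prod.1 (hf.1 hξ)).1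
    exact hgu ⟨ξ, hξβ⟩ δ hξ ▸ hlt ⟨ξ, hξβ⟩
  strongLimit β hβ := by
    have hp := powerset_mem_vonNeumann hκ (toZFSet_mem_vonNeumann (hβ.trans h))
    -- The bound `γ` is the initial ordinal of the true power set of `β`, which is also its power
    -- set in `V_κ`.
    have hγ : β.toZFSet.powerset.card.ord < μ.ord := by
      rw [ord_lt_ord, ZFSet.card_powerset, Ordinal.card_toZFSet]
      exact hμ.isStrongPrelimit (Cardinal.lt_ord.1 hβ)
    obtain ⟨f, hf, hinj⟩ := exists_injective_isFunc β.toZFSet.powerset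
    refine ⟨_, hp, fun x => ?_, _, hγ, f, ?_, hf, hinj⟩
    · rw [ZFSet.mem_powerset]
      exact ⟨fun hx => ⟨ZFSet.mem_vonNeumann_of_subset hx
        (toZFSet_mem_vonNeumann (hβ.trans h)), hx⟩, fun hx => hx.2⟩
    · exact ZFSet.mem_vonNeumann_of_subset hf.1
        (prod_mem_vonNeumann hκ hp (toZFSet_mem_vonNeumann (hγ.trans h)))

-- Definable predicates and reflection on a club

/-- The set defined over `V_κ` by a formula with a finite list of parameters. -/
def definedSet (κ : Ordinal.{u}) (c : Σ n, Lmem.Formula (Fin (n + 1))) (l : List ZFSet.{u}) :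
    Set ZFSet.{u} :=
  {x | ∃ (p : Fin c.1 → orderDom Set.univ κ 0) (y : orderDom Set.univ κ 0),
    l = List.ofFn (fun i => (p i : ZFSet.{u})) ∧ (y : ZFSet.{u}) = x ∧
      c.2.Realize (Fin.cons y p : Fin (c.1 + 1) → orderDom Set.univ κ 0)}

/-- A definable set is defined by a formula with a finite list of parameters. -/
theorem exists_formula_of_definable₁ {L : FirstOrder.Language.{0, 0}} {M : Type*} [L.Structure M]
    {s : Set M} (hs : (Set.univ : Set M).Definable₁ L s) :
    ∃ (n : ℕ) (φ : L.Formula (Fin (n + 1))) (p : Fin n → M),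
      ∀ x, x ∈ s ↔ φ.Realize (Fin.cons x p : Fin (n + 1) → M) := by
  obtain ⟨A, -, hA⟩ := Set.definable_iff_finitely_definable.1 hs
  obtain ⟨φ, hφ⟩ := Set.definable_iff_exists_formula_sum.1 hA
  let e := A.equivFin
  -- Variable `0` is the element tested; the parameters occupy the successor positions.
  refine ⟨A.card, φ.relabel (Sum.elim (fun a => (e a).succ) fun _ => 0),
    fun i => (e.symm i : M), fun x => ?_⟩
  rw [FirstOrder.Language.Formula.realize_relabel]
  have h : x ∈ s ↔ (fun _ : Fin 1 => x) ∈ {x : Fin 1 → M | x 0 ∈ s} := Iff.rfl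
  rw [h, hφ, Set.mem_ofPred_eq]
  refine iff_of_eq (congrArg _ (funext fun i => ?_))
  rcases i with a | i <;> simp

/-- Elementarity lets the same formula and parameters be read over `V_κ`. The predicate then has a
description independent of `a`, to which closure applies. -/
theorem IsDefinableOver.exists_eq_definedSet_inter {a κ : Ordinal.{u}} (h : a ≤ κ)
    (hc : ∀ c l, (∀ x ∈ l, x ∈ ZFSet.vonNeumann a) →
      (∃ β < κ, IsWitnessRank κ c l β) → ∃ β < a, IsWitnessRank κ c l β) {A : Set ZFSet.{u}}
    (hA : IsDefinableOver (orderDom Set.univ a 0) A) :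
    ∃ c l, (∀ x ∈ l, x ∈ ZFSet.vonNeumann a) ∧ A = definedSet κ c l ∩ orderDom Set.univ a 0 := by
  obtain ⟨n, φ, p, hφ⟩ := exists_formula_of_definable₁ hA.2
  have key : ∀ x, (Fin.cons (orderDomInclusion h x) (orderDomInclusion h ∘ p) :
      Fin (n + 1) → orderDom Set.univ κ 0) =
        orderDomInclusion h ∘ (Fin.cons x p : Fin (n + 1) → orderDom Set.univ a 0) := fun x =>
    funext fun i => by cases i using Fin.cases <;> rfl
  refine ⟨⟨n, φ⟩, List.ofFn fun i => (p i : ZFSet.{u}),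
    by simpa [List.mem_ofFn] using fun i => (p i).2.2, Set.ext fun x => ⟨fun hx => ?_, ?_⟩⟩
  · refine ⟨⟨orderDomInclusion h ∘ p, orderDomInclusion h ⟨x, hA.1 hx⟩, rfl, rfl, ?_⟩, hA.1 hx⟩
    rw [key, realize_orderDomInclusion h hc]
    exact (hφ ⟨x, hA.1 hx⟩).1 hx
  · rintro ⟨⟨p', y, hp, rfl, hy⟩, hx⟩
    obtain rfl : orderDomInclusion h ∘ p = p' :=
      funext fun i => Subtype.ext (congrFun (List.ofFn_injective hp) i)
    have hy' : φ.Realize (Fin.cons (orderDomInclusion h ⟨y, hx⟩) (orderDomInclusion h ∘ p) :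
        Fin (n + 1) → orderDom Set.univ κ 0) := hy
    rw [key, realize_orderDomInclusion h hc] at hy'
    exact (hφ ⟨y, hx⟩).2 hy'

theorem reflects_of_closed {a κ : Ordinal.{u}} (h : a < κ) (h0 : 0 < a)
    (hc : ∀ c l, (∀ x ∈ l, x ∈ ZFSet.vonNeumann a) →
      (∃ β < κ, IsWitnessRank κ c l β) → ∃ β < a, IsWitnessRank κ c l β)
    (hr : ∀ (c : (Σ n, Lmem.Formula (Fin (n + 1))) × HOFormula) (l),
      (∀ x ∈ l, x ∈ ZFSet.vonNeumann a) →
      (∃ β < κ, 0 < β ∧ Holds Set.univ β (definedSet κ c.1 l ∩ orderDom Set.univ β 0) c.2) →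
      ∃ β < a, 0 < β ∧ Holds Set.univ β (definedSet κ c.1 l ∩ orderDom Set.univ β 0) c.2)
    (m n : ℕ) : Reflects Set.univ m n a := by
  intro A hA Φ _ _ hΦ
  obtain ⟨c, l, hl, rfl⟩ := hA.exists_eq_definedSet_inter h.le hc
  -- The ordinal `a` is itself the witness below `κ`.
  obtain ⟨β, hβ, hβ0, H⟩ := hr (c, Φ) l hl ⟨a, h, h0, hΦ⟩
  refine ⟨β, hβ0, hβ, ?_⟩
  have hs : orderDom Set.univ β 0 ⊆ orderDom Set.univ a 0 := fun x hx =>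
    ⟨trivial, ZFSet.vonNeumann_subset_of_le hβ.le hx.2⟩
  rwa [Set.inter_assoc, Set.inter_eq_self_of_subset_right hs]

theorem IsMahlo.isStationary_setOf_isPiReflecting {κ : Cardinal.{u}} (hκ : IsMahlo κ) (m n : ℕ) :
    IsStationary {a : Set.Iio κ.ord | ∃ μ : Cardinal.{u},
      IsPiReflecting m n μ ∧ (a : Ordinal.{u}) = μ.ord} := by
  intro C hC
  -- Cofinality other than `ℵ₀` is what makes the intersection of two clubs a club.
  have hcof : Order.cof (Set.Iio κ.ord) ≠ ℵ₀ := by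
    rw [Ordinal.cof_Iio, ← Ordinal.lift_cof, hκ.1.isRegular.cof_ord]
    simpa using hκ.1.aleph0_lt.ne'
  obtain ⟨a, ⟨μ, hμ, ha⟩, ⟨haC, hc⟩, hr⟩ := hκ.2 ((hC.inter hcof
    (isClub_setOf_closed hκ.1 (IsWitnessRank κ.ord))).inter hcof
    (isClub_setOf_closed hκ.1 fun (c : (Σ n, Lmem.Formula (Fin (n + 1))) × HOFormula) l β =>
      0 < β ∧ Holds Set.univ β (definedSet κ.ord c.1 l ∩ orderDom Set.univ β 0) c.2))
  refine ⟨a, ⟨μ, ⟨hμ, ?_⟩, ha⟩, haC⟩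
  rw [← ha]
  refine reflects_of_closed a.2 ?_ hc hr m n
  rw [ha]
  simpa using hμ.pos

end Reflection

theorem lemma3p1 (κ : Cardinal.{u}) (hκ : Reflection.IsMahlo κ) :
    (∀ m n : ℕ, IsStationary
      {a : Set.Iio κ.ord | ∃ μ : Cardinal.{u},
        Reflection.IsPiReflecting m n μ ∧ (a : Ordinal.{u}) = μ.ord}) ∧
    (Reflection.ModelsZFC {x : ZFSet.{u} | x ∈ ZFSet.vonNeumann κ.ord} ∧
      ∃ α : Ordinal.{u},
        Reflection.IsPiReflectingIn {x : ZFSet.{u} | x ∈ ZFSet.vonNeumann κ.ord} 1 1 α) := by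
  have hs := hκ.isStationary_setOf_isPiReflecting
  obtain ⟨a, μ, hμ, ha⟩ := (hs 1 1).nonempty
  have hlt : μ.ord < κ.ord := ha ▸ a.2
  exact ⟨hs, Reflection.modelsZFC_vonNeumann hκ.1, μ.ord,
    Reflection.isInaccessibleIn_vonNeumann hκ.1 hμ.1 hlt, hμ.2.vonNeumann hκ.1 hlt⟩
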